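/- For a real polynomial $p$ in one variable write $\|p\|_\infty := \sup_{|x|\le 1}|p(x)|$. Let $n \ge 1$ be an integer and let $p_1,\dots,p_n$ be real polynomials of degree at most $n$ with $\|p_i\|_\infty \le 1$ for every $i \in \{1,\dots,n\}$. Then there exist signs $x_1,\dots,x_n \in \{-1,1\}$ such that \[\Big\|\sum_{i=1}^n x_i p_i\Big\|_\infty < 30\sqrt{n}.\] -/

import Mathlib

/-- The Chebyshev norm `sup_{|x| ≤ 1} |p(x)|` of a real polynomial. The supremum is over a nonempty
set that is bounded above (see `bddAbove_abs_eval`), so it is a genuine least upper bound. -/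
noncomputable def chebyshevNorm (p : Polynomial ℝ) : ℝ :=
  sSup ((fun x : ℝ => |p.eval x|) '' {x : ℝ | |x| ≤ 1})

theorem bddAbove_abs_eval (p : Polynomial ℝ) :
    BddAbove ((fun x : ℝ => |p.eval x|) '' {x : ℝ | |x| ≤ 1}) := by
  have h : {x : ℝ | |x| ≤ 1} = Set.Icc (-1) 1 := by
    ext x
    simp [abs_le]
  rw [h]
  exact isCompact_Icc.bddAbove_image (p.continuous.abs.continuousOn)

/-! Sampling makes the problem finite: for `z` on the unit circle, `z ^ n * p(Re z)` is a polynomial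
in `z` of degree at most `2n`, and its values at the `4n`-th roots of unity control it up to a
factor `√2` (`abs_eval_le_of_roots`). With both signs this leaves `8n` linear forms in `n` variables
to be bounded by `O(√n)`, as in Spencer's discrepancy theorem.

A potential argument does this (`exists_signs_inner_le`). All forms stay below a barrier that rises
with `‖x‖²`, by at most `K√n` in total, and the inverse squares of the slacks sum to at most `1/c²`.
Take such a point of the cube of maximal norm. If 8 or more coordinates were free, a dimension count
and averaging would give a direction orthogonal to the point, to the gradient of the potential and
to the tightest forms, along which the rise of the barrier beats the second-order growth of the
potential; a small move would increase the norm (`exists_norm_gt_of_many_active`). So fewer than 8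
coordinates need rounding. -/

/-! ### Choice of direction and second-order barrier estimate -/

open scoped RealInnerProductSpace in
/-- A direction supported on `A`, orthogonal to few given vectors, along which a weighted sum of
squares of linear forms with coefficients in `[-1, 1]` is at most twice its average size. -/
theorem exists_direction {n : ℕ} {ι : Type*} [Fintype ι] (A : Finset (Fin n))
    (S : Finset (EuclideanSpace ℝ (Fin n))) (w : ι → ℝ) (hw : ∀ j, 0 ≤ w j)
    (a : ι → EuclideanSpace ℝ (Fin n)) (ha : ∀ j i, |a j i| ≤ 1)
    (hA : A.Nonempty) (hS : 2 * S.card ≤ A.card) :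
    ∃ u : EuclideanSpace ℝ (Fin n), u ≠ 0 ∧ (∀ i ∉ A, u i = 0) ∧ (∀ s ∈ S, ⟪s, u⟫ = 0) ∧
      ∑ j, w j * ⟪a j, u⟫ ^ 2 ≤ 2 * (∑ j, w j) * ‖u‖ ^ 2 := by
  classical
  let T : Finset (EuclideanSpace ℝ (Fin n)) :=
    S ∪ Aᶜ.image (fun i => EuclideanSpace.single i (1 : ℝ))
  let V : Submodule ℝ (EuclideanSpace ℝ (Fin n)) :=
    (Submodule.span ℝ (T : Set (EuclideanSpace ℝ (Fin n))))ᗮ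
  have hVmem : ∀ u ∈ V, ∀ t ∈ T, ⟪t, u⟫ = 0 := fun u hu t ht =>
    (Submodule.mem_orthogonal _ _).1 hu t (Submodule.subset_span ht)
  have hsupp : ∀ u ∈ V, ∀ i ∉ A, u i = 0 := by
    intro u hu i hi
    have h := hVmem u hu (EuclideanSpace.single i (1 : ℝ))
      (Finset.mem_union_right _ (Finset.mem_image_of_mem _ (Finset.mem_compl.2 hi)))
    simpa [EuclideanSpace.inner_single_left] using h
  -- Support in `A` costs `n - |A|` linear conditions and `S` at most `|A|/2` more.
  have hdim : A.card ≤ 2 * Module.finrank ℝ V := by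
    have h1 : Module.finrank ℝ (Submodule.span ℝ (T : Set (EuclideanSpace ℝ (Fin n))))
        ≤ T.card := finrank_span_finset_le_card T
    have h2 := Submodule.finrank_add_finrank_orthogonal
      (Submodule.span ℝ (T : Set (EuclideanSpace ℝ (Fin n))))
    have h3 : T.card ≤ S.card + (Aᶜ).card :=
      (Finset.card_union_le _ _).trans (Nat.add_le_add_left Finset.card_image_le _)
    have h4 : A.card + (Aᶜ).card = n := by simp
    rw [finrank_euclideanSpace_fin] at h2
    change _ + Module.finrank ℝ V = n at h2
    omega
  have hApos := hA.card_pos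
  let b := stdOrthonormalBasis ℝ V
  let e : Fin (Module.finrank ℝ V) → EuclideanSpace ℝ (Fin n) := fun k => (b k : _)
  have he : Orthonormal ℝ e := b.orthonormal.comp_linearIsometry V.subtypeₗᵢ
  have heV : ∀ k, e k ∈ V := fun k => (b k).2
  have hbessel : ∀ j, ∑ k, ⟪a j, e k⟫ ^ 2 ≤ A.card := by
    intro j
    -- Each `e k` vanishes off `A`, so `a j` may be truncated to `A`; Bessel then gives `|A|`
    -- instead of `n`.
    let a' : EuclideanSpace ℝ (Fin n) := WithLp.toLp 2 (fun i => if i ∈ A then a j i else 0)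
    have h1 : ∀ k, ⟪a j, e k⟫ = ⟪e k, a'⟫ := by
      intro k
      rw [PiLp.inner_apply, PiLp.inner_apply]
      refine Finset.sum_congr rfl fun i _ => ?_
      by_cases hi : i ∈ A
      · simp [a', hi, mul_comm]
      · simp [a', hi, hsupp _ (heV k) i hi]
    have h2 : ∑ k, ‖⟪e k, a'⟫‖ ^ 2 ≤ ‖a'‖ ^ 2 :=
      he.sum_inner_products_le a'
    have h3 : ‖a'‖ ^ 2 ≤ A.card := by
      rw [EuclideanSpace.norm_sq_eq]
      have : ∀ i, ‖a' i‖ ^ 2 ≤ if i ∈ A then (1 : ℝ) else 0 := by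
        intro i
        by_cases hi : i ∈ A
        · simpa [a', hi] using ha j i
        · simp [a', hi]
      refine (Finset.sum_le_sum fun i _ => this i).trans ?_
      simp
    calc ∑ k, ⟪a j, e k⟫ ^ 2 = ∑ k, ‖⟪e k, a'⟫‖ ^ 2 := by simp [h1]
      _ ≤ _ := h2.trans h3
  have hd : 0 < Module.finrank ℝ V := by omega
  have : Nonempty (Fin (Module.finrank ℝ V)) := ⟨⟨0, hd⟩⟩
  obtain ⟨k, -, hk⟩ : ∃ k ∈ (Finset.univ : Finset (Fin (Module.finrank ℝ V))),
      ∑ j, w j * ⟪a j, e k⟫ ^ 2 ≤ 2 * ∑ j, w j := by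
    refine Finset.exists_le_of_sum_le Finset.univ_nonempty ?_
    rw [Finset.sum_comm]
    have hdim' : (A.card : ℝ) ≤ 2 * Module.finrank ℝ V := by exact_mod_cast hdim
    calc ∑ j, ∑ k, w j * ⟪a j, e k⟫ ^ 2 = ∑ j, w j * ∑ k, ⟪a j, e k⟫ ^ 2 := by
          simp [Finset.mul_sum]
      _ ≤ ∑ j, w j * (2 * Module.finrank ℝ V) :=
          Finset.sum_le_sum fun j _ =>
            mul_le_mul_of_nonneg_left ((hbessel j).trans hdim') (hw j)
      _ = _ := by
          rw [← Finset.sum_mul]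
          simp
          ring
  have hnorm : ‖e k‖ = 1 := he.1 k
  refine ⟨e k, fun h => by simp [h] at hnorm, hsupp _ (heV k),
    fun s hs => hVmem _ (heV k) s (Finset.mem_union_left _ hs), ?_⟩
  simpa [hnorm] using hk

/-- The exact remainder keeps the second-order term a continuous function of the step, so its sign
can be read off at step zero. -/
theorem inv_sq_taylor {s t : ℝ} (hs : s ≠ 0) (ht : t ≠ 0) :
    1 / t ^ 2 - 1 / s ^ 2 + 2 * (t - s) / s ^ 3 =
      (t - s) ^ 2 * (3 * s + 2 * (t - s)) / (s ^ 3 * t ^ 2) := by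
  field_simp
  ring

/-- A second-order decrease of an inverse-square barrier. -/
theorem eventually_sum_inv_sq_le {ι : Type*} [Fintype ι] (s v : ι → ℝ) (β : ℝ)
    (hs : ∀ j, 0 < s j) (h1 : ∑ j, v j / s j ^ 3 = 0)
    (h2 : 3 * ∑ j, v j ^ 2 / s j ^ 4 < 2 * β * ∑ j, 1 / s j ^ 3) :
    ∀ᶠ ε in nhds (0 : ℝ), (∀ j, 0 < s j + ε * (β * ε - v j)) ∧
      ∑ j, 1 / (s j + ε * (β * ε - v j)) ^ 2 ≤ ∑ j, 1 / s j ^ 2 := by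
  have hpos : ∀ᶠ ε in nhds (0 : ℝ), ∀ j, 0 < s j + ε * (β * ε - v j) := by
    rw [Filter.eventually_all]
    intro j
    have : ContinuousAt (fun ε : ℝ => s j + ε * (β * ε - v j)) 0 := by fun_prop
    exact continuousAt_const.eventually_lt this (by simpa using hs j)
  -- Once the linear term cancels by `h1`, the change of the potential is exactly `ε ^ 2 * R ε`.
  let R : ℝ → ℝ := fun ε => ∑ j, ((β * ε - v j) ^ 2 * (3 * s j + 2 * (ε * (β * ε - v j))) /
    (s j ^ 3 * (s j + ε * (β * ε - v j)) ^ 2) - 2 * β / s j ^ 3)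
  have hR : ContinuousAt R 0 := by
    refine tendsto_finsetSum _ fun j _ => ?_
    have hj := hs j
    refine ContinuousAt.sub (ContinuousAt.div (by fun_prop) (by fun_prop) ?_) (by fun_prop)
    simp
    exact hj.ne'
  have hR0 : R 0 < 0 := by
    have : R 0 = 3 * ∑ j, v j ^ 2 / s j ^ 4 - 2 * β * ∑ j, 1 / s j ^ 3 := by
      simp only [R, Finset.mul_sum, ← Finset.sum_sub_distrib]
      refine Finset.sum_congr rfl fun j _ => ?_
      have := (hs j).ne'
      simp only [mul_zero, zero_mul, add_zero, zero_sub]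
      field_simp
    linarith
  filter_upwards [hpos, hR.eventually_lt continuousAt_const hR0] with ε hε hRε
  refine ⟨hε, ?_⟩
  have key : ∑ j, 1 / (s j + ε * (β * ε - v j)) ^ 2 - ∑ j, 1 / s j ^ 2
      - 2 * ε * ∑ j, v j / s j ^ 3 = ε ^ 2 * R ε := by
    simp only [R, Finset.mul_sum, ← Finset.sum_sub_distrib]
    refine Finset.sum_congr rfl fun j _ => ?_
    have h3 := inv_sq_taylor (hs j).ne' (hε j).ne'
    rw [add_sub_cancel_left] at h3
    have h4 : 2 * ε * (v j / s j ^ 3) = 2 * (ε * (ε * β)) / s j ^ 3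
        - 2 * (ε * (β * ε - v j)) / s j ^ 3 := by ring
    rw [h4]
    have h5 : 1 / (s j + ε * (β * ε - v j)) ^ 2 - 1 / s j ^ 2
        = (ε * (β * ε - v j)) ^ 2 * (3 * s j + 2 * (ε * (β * ε - v j))) /
          (s j ^ 3 * (s j + ε * (β * ε - v j)) ^ 2) - 2 * (ε * (β * ε - v j)) / s j ^ 3 := by
      linarith
    rw [h5]
    ring
  rw [h1] at key
  nlinarith [sq_nonneg ε]

/-! ### Sampling at roots of unity -/

open scoped ComplexConjugate

theorem sum_pow_mul_conj_pow {N : ℕ} {ζ : ℂ} (hζ : IsPrimitiveRoot ζ N) (hN : N ≠ 0)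
    {a b : ℕ} (ha : a < N) (hb : b < N) :
    ∑ j ∈ Finset.range N, (ζ ^ j) ^ a * conj (ζ ^ j) ^ b = if a = b then (N : ℂ) else 0 := by
  have hnorm : ‖ζ‖ = 1 := hζ.norm'_eq_one hN
  have hconj : ζ * conj ζ = 1 := by
    rw [Complex.mul_conj, Complex.normSq_eq_norm_sq, hnorm]; simp
  have h : ∀ j, (ζ ^ j) ^ a * conj (ζ ^ j) ^ b = (ζ ^ a * conj ζ ^ b) ^ j := by
    intro j
    rw [map_pow, mul_pow]
    ring
  simp only [h]
  have hcc : ∀ k, ζ ^ k * conj ζ ^ k = 1 := fun k => by rw [← mul_pow, hconj, one_pow]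
  split_ifs with hab
  · subst hab
    simp [hcc]
  · have hne : ζ ^ a * conj ζ ^ b ≠ 1 := by
      intro h1
      apply hab
      apply hζ.pow_inj ha hb
      calc ζ ^ a = ζ ^ a * (ζ ^ b * conj ζ ^ b) := by rw [hcc, mul_one]
        _ = (ζ ^ a * conj ζ ^ b) * ζ ^ b := by ring
        _ = ζ ^ b := by rw [h1, one_mul]
    have hpow : (ζ ^ a * conj ζ ^ b) ^ N = 1 := by
      have : (ζ ^ a * conj ζ ^ b) ^ N = (ζ ^ N) ^ a * conj (ζ ^ N) ^ b := by
        rw [map_pow]; ring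
      rw [this, hζ.pow_eq_one]; simp
    have := mul_neg_geom_sum (ζ ^ a * conj ζ ^ b) N
    rw [hpow, sub_self] at this
    exact (mul_eq_zero.1 this).resolve_left (sub_ne_zero.2 (Ne.symm hne))

/-- Discrete Fourier interpolation at the `N`-th roots of unity. -/
theorem sum_eval_mul_geom_sum {N : ℕ} {ζ : ℂ} (hζ : IsPrimitiveRoot ζ N) (hN : N ≠ 0)
    (Q : Polynomial ℂ) (hQ : Q.natDegree < N) (z : ℂ) :
    ∑ j ∈ Finset.range N, Q.eval (ζ ^ j) * ∑ a ∈ Finset.range N, (z * conj (ζ ^ j)) ^ a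
      = N * Q.eval z := by
  simp only [Polynomial.eval_eq_sum_range' hQ, Finset.sum_mul_sum]
  rw [Finset.sum_comm, Finset.mul_sum]
  refine Finset.sum_congr rfl fun k hk => ?_
  rw [Finset.sum_comm]
  have : ∀ a ∈ Finset.range N, ∑ j ∈ Finset.range N,
      Q.coeff k * (ζ ^ j) ^ k * (z * conj (ζ ^ j)) ^ a
        = if k = a then N * (Q.coeff k * z ^ k) else 0 := by
    intro a ha
    have h := sum_pow_mul_conj_pow hζ hN (Finset.mem_range.1 hk) (Finset.mem_range.1 ha)
    calc _ = Q.coeff k * z ^ a * ∑ j ∈ Finset.range N, (ζ ^ j) ^ k * conj (ζ ^ j) ^ a := by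
          rw [Finset.mul_sum]
          refine Finset.sum_congr rfl fun j _ => ?_
          rw [mul_pow]; ring
      _ = _ := by
          rw [h]
          split_ifs with hka
          · subst hka; ring
          · simp
  rw [Finset.sum_congr rfl this]
  simp [Finset.mem_range.1 hk]

/-- Expanding the square, orthogonality leaves only the diagonal; `L ≤ N` keeps the exponents
distinct modulo `N`. -/
theorem sum_norm_sq_geom_sum {N : ℕ} {ζ : ℂ} (hζ : IsPrimitiveRoot ζ N) (hN : N ≠ 0)
    {L : ℕ} (hL : L ≤ N) {z : ℂ} (hz : ‖z‖ = 1) :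
    ∑ j ∈ Finset.range N, ‖∑ a ∈ Finset.range L, (z * conj (ζ ^ j)) ^ a‖ ^ 2 = N * L := by
  have hzz : ∀ a, z ^ a * conj z ^ a = 1 := fun a => by
    rw [← mul_pow, Complex.mul_conj, Complex.normSq_eq_norm_sq, hz]; simp
  have h : ((∑ j ∈ Finset.range N, ‖∑ a ∈ Finset.range L, (z * conj (ζ ^ j)) ^ a‖ ^ 2 : ℝ) : ℂ)
      = N * L := by
    push_cast
    simp only [← Complex.mul_conj', map_sum, Finset.sum_mul_sum]
    rw [Finset.sum_comm]
    have : ∀ a ∈ Finset.range L, ∑ j ∈ Finset.range N, ∑ b ∈ Finset.range L,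
        (z * conj (ζ ^ j)) ^ a * conj ((z * conj (ζ ^ j)) ^ b) = N := by
      intro a ha
      rw [Finset.sum_comm]
      have hb : ∀ b ∈ Finset.range L, ∑ j ∈ Finset.range N,
          (z * conj (ζ ^ j)) ^ a * conj ((z * conj (ζ ^ j)) ^ b) = if b = a then (N : ℂ) else 0 := by
        intro b hb
        have h := sum_pow_mul_conj_pow hζ hN ((Finset.mem_range.1 hb).trans_le hL)
          ((Finset.mem_range.1 ha).trans_le hL)
        calc _ = z ^ a * conj z ^ b * ∑ j ∈ Finset.range N, (ζ ^ j) ^ b * conj (ζ ^ j) ^ a := by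
              rw [Finset.mul_sum]
              refine Finset.sum_congr rfl fun j _ => ?_
              simp only [map_mul, map_pow, Complex.conj_conj, mul_pow]; ring
          _ = _ := by
              rw [h]
              split_ifs with hba
              · subst hba; rw [hzz, one_mul]
              · simp
      rw [Finset.sum_congr rfl hb]
      simp [Finset.mem_range.1 ha]
    rw [Finset.sum_congr rfl this]
    simp [mul_comm]
  exact_mod_cast h

/-- Sampling on the circle: a polynomial of degree at most `2n` is controlled by its values at
the `4n`-th roots of unity. -/
theorem norm_eval_sq_le_of_roots {n : ℕ} (hn : n ≠ 0) {ζ : ℂ} (hζ : IsPrimitiveRoot ζ (4 * n))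
    (P : Polynomial ℂ) (hP : P.natDegree ≤ 2 * n) {M : ℝ} (hM : ∀ j, ‖P.eval (ζ ^ j)‖ ≤ M)
    {z : ℂ} (hz : ‖z‖ = 1) : ‖P.eval z‖ ^ 2 ≤ 2 * M ^ 2 := by
  have hN : 4 * n ≠ 0 := by omega
  have hM0 : 0 ≤ M := (norm_nonneg _).trans (hM 0)
  have hzz : ∀ a, z ^ a * conj z ^ a = 1 := fun a => by
    rw [← mul_pow, Complex.mul_conj, Complex.normSq_eq_norm_sq, hz]; simp
  let D : ℕ → ℕ → ℂ := fun L j => ∑ a ∈ Finset.range L, (z * conj (ζ ^ j)) ^ a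
  -- Since `deg P ≤ 2n`, each shift `X ^ b * P` with `b < 2n` still has degree below `4n`, so
  -- interpolation is exact. Summing over `b` replaces the Dirichlet kernel by a product of two
  -- kernels, whose `ℓ¹` norm Cauchy–Schwarz bounds without a logarithm.
  have hb : ∀ b ∈ Finset.range (2 * n),
      ∑ j ∈ Finset.range (4 * n), P.eval (ζ ^ j) * conj ((z * conj (ζ ^ j)) ^ b) * D (4 * n) j
        = (4 * n : ℕ) * P.eval z := by
    intro b hb
    have hdeg : (Polynomial.X ^ b * P).natDegree < 4 * n := by
      have := Polynomial.natDegree_mul_le (p := (Polynomial.X ^ b : Polynomial ℂ)) (q := P)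
      rw [Polynomial.natDegree_X_pow] at this
      have := Finset.mem_range.1 hb
      omega
    have h := sum_eval_mul_geom_sum hζ hN _ hdeg z
    simp only [Polynomial.eval_mul, Polynomial.eval_pow, Polynomial.eval_X] at h
    calc _ = conj z ^ b * ∑ j ∈ Finset.range (4 * n),
          (ζ ^ j) ^ b * P.eval (ζ ^ j) * D (4 * n) j := by
            rw [Finset.mul_sum]
            refine Finset.sum_congr rfl fun j _ => ?_
            simp only [map_mul, map_pow, Complex.conj_conj, mul_pow]; ring
      _ = conj z ^ b * ((4 * n : ℕ) * (z ^ b * P.eval z)) := by rw [h]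
      _ = (4 * n : ℕ) * P.eval z * (z ^ b * conj z ^ b) := by ring
      _ = _ := by rw [hzz, mul_one]
  have hid : ∑ j ∈ Finset.range (4 * n), P.eval (ζ ^ j) * (conj (D (2 * n) j) * D (4 * n) j)
      = (2 * n : ℕ) * ((4 * n : ℕ) * P.eval z) := by
    have h := Finset.sum_congr rfl hb
    rw [Finset.sum_comm, Finset.sum_const, Finset.card_range, nsmul_eq_mul] at h
    rw [← h]
    refine Finset.sum_congr rfl fun j _ => ?_
    rw [← Finset.sum_mul, ← Finset.mul_sum, ← map_sum, mul_assoc]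
  have hle : (2 * n : ℝ) * (4 * n * ‖P.eval z‖) ≤
      M * ∑ j ∈ Finset.range (4 * n), ‖D (2 * n) j‖ * ‖D (4 * n) j‖ := by
    have h1 : (2 * n : ℝ) * (4 * n * ‖P.eval z‖) =
        ‖((2 * n : ℕ) : ℂ) * ((4 * n : ℕ) * P.eval z)‖ := by
      simp only [norm_mul, Complex.norm_natCast]
      push_cast
      ring
    rw [h1, ← hid, Finset.mul_sum]
    refine (norm_sum_le _ _).trans (Finset.sum_le_sum fun j _ => ?_)
    rw [norm_mul, norm_mul, RCLike.norm_conj]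
    exact mul_le_mul_of_nonneg_right (hM j) (by positivity)
  have hCS := Finset.sum_mul_sq_le_sq_mul_sq (Finset.range (4 * n))
    (fun j => ‖D (2 * n) j‖) (fun j => ‖D (4 * n) j‖)
  rw [sum_norm_sq_geom_sum hζ hN (by omega) hz, sum_norm_sq_geom_sum hζ hN le_rfl hz] at hCS
  push_cast at hCS
  have hn0 : (0 : ℝ) < n := by positivity
  have hsq := pow_le_pow_left₀ (by positivity) hle 2
  rw [mul_pow M] at hsq
  have h3 := hsq.trans (mul_le_mul_of_nonneg_left hCS (sq_nonneg M))
  have h4 : (64 * (n : ℝ) ^ 4) * ‖P.eval z‖ ^ 2 ≤ (64 * (n : ℝ) ^ 4) * (2 * M ^ 2) := by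
    nlinarith
  exact le_of_mul_le_mul_left h4 (by positivity)

/-- Sampling on the interval: a real polynomial of degree at most `n` is controlled on `[-1, 1]` by
its values at the real parts of the `4n`-th roots of unity. -/
theorem abs_eval_le_of_roots {n : ℕ} (hn : n ≠ 0) {ζ : ℂ} (hζ : IsPrimitiveRoot ζ (4 * n))
    (p : Polynomial ℝ) (hp : p.natDegree ≤ n) {M : ℝ} (hM : ∀ j, |p.eval (ζ ^ j).re| ≤ M)
    {x : ℝ} (hx : |x| ≤ 1) : |p.eval x| ≤ Real.sqrt 2 * M := by
  have hM0 : 0 ≤ M := (abs_nonneg _).trans (hM 0)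
  -- This is `z ^ n * p((z + z⁻¹) / 2)` with denominators cleared.
  let P : Polynomial ℂ := ∑ k ∈ Finset.range (n + 1), Polynomial.C (p.coeff k : ℂ) *
    (Polynomial.X ^ (n - k) * (Polynomial.C (1 / 2) * (Polynomial.X ^ 2 + 1)) ^ k)
  have hP : P.natDegree ≤ 2 * n := by
    refine Polynomial.natDegree_sum_le_of_forall_le _ _ fun k hk => ?_
    have hk' : k ≤ n := Nat.lt_succ_iff.1 (Finset.mem_range.1 hk)
    have h2 : (Polynomial.C (1 / 2 : ℂ) * (Polynomial.X ^ 2 + 1)).natDegree ≤ 2 := by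
      compute_degree
    have h3 := Polynomial.natDegree_pow_le_of_le k h2
    have h4 : (Polynomial.X ^ (n - k) : Polynomial ℂ).natDegree ≤ n - k := by simp
    have h5 := Polynomial.natDegree_mul_le_of_le h4 h3
    refine (Polynomial.natDegree_C_mul_le _ _).trans (h5.trans ?_)
    omega
  have heval : ∀ z : ℂ, ‖z‖ = 1 → ‖P.eval z‖ = |p.eval z.re| := by
    intro z hz
    have hre : z ^ 2 + 1 = z * (2 * (z.re : ℂ)) := by
      have h1 : z * conj z = 1 := by
        rw [Complex.mul_conj, Complex.normSq_eq_norm_sq, hz]; simp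
      have h2 : z + conj z = 2 * (z.re : ℂ) := by
        rw [Complex.add_conj]; push_cast; ring
      rw [← h2, mul_add, h1]; ring
    have h : P.eval z = z ^ n * ((p.eval z.re : ℝ) : ℂ) := by
      rw [Polynomial.eval_eq_sum_range' (Nat.lt_succ_of_le hp)]
      simp only [P, Polynomial.eval_finsetSum]
      push_cast
      rw [Finset.mul_sum]
      refine Finset.sum_congr rfl fun k hk => ?_
      have hk' : k ≤ n := Nat.lt_succ_iff.1 (Finset.mem_range.1 hk)
      simp only [Polynomial.eval_mul, Polynomial.eval_C, Polynomial.eval_pow, Polynomial.eval_X,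
        Polynomial.eval_add, Polynomial.eval_one]
      rw [hre]
      have : z ^ n = z ^ (n - k) * z ^ k := by rw [← pow_add, Nat.sub_add_cancel hk']
      rw [this]
      have h2 : (1 / 2 : ℂ) * (z * (2 * (z.re : ℂ))) = z * z.re := by ring
      rw [h2, mul_pow]
      ring
    rw [h, norm_mul, norm_pow, hz, one_pow, one_mul, Complex.norm_real, Real.norm_eq_abs]
  have hζn : ‖ζ‖ = 1 := hζ.norm'_eq_one (by omega)
  have hz : ‖Complex.exp (Real.arccos x * Complex.I)‖ = 1 := Complex.norm_exp_ofReal_mul_I _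
  have hzx : (Complex.exp (Real.arccos x * Complex.I)).re = x := by
    rw [Complex.exp_ofReal_mul_I_re, Real.cos_arccos (abs_le.1 hx).1 (abs_le.1 hx).2]
  have h := norm_eval_sq_le_of_roots hn hζ P hP (M := M)
    (fun j => by rw [heval _ (by rw [norm_pow, hζn, one_pow])]; exact hM j) hz
  rw [heval _ hz, hzx] at h
  refine abs_le_of_sq_le_sq' ?_ (by positivity) |>.2
  rw [mul_pow, Real.sq_sqrt (by norm_num)]
  exact h

/-! ### The moving barrier and the discrepancy bound -/

open scoped RealInnerProductSpace

/-- The height of the moving barrier after energy `σ`. -/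
noncomputable def barrierHeight (n : ℕ) (κ K σ : ℝ) : ℝ :=
  κ + K * (Real.sqrt n - Real.sqrt (n - σ))

theorem continuous_barrierHeight (n : ℕ) (κ K : ℝ) : Continuous (barrierHeight n κ K) := by
  unfold barrierHeight
  fun_prop

/-- The barrier is convex in the energy, hence lies above its tangent. The slope grows as the
remaining energy `n - σ` shrinks, matching the weaker bound on slacks when few coordinates are free.
-/
theorem barrierHeight_add_ge {n : ℕ} {κ K σ δ : ℝ} (hK : 0 ≤ K) (hσ : σ < n) (hδ : σ + δ ≤ n) :
    barrierHeight n κ K σ + K / (2 * Real.sqrt (n - σ)) * δ ≤ barrierHeight n κ K (σ + δ) := by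
  have hpos : 0 < Real.sqrt (n - σ) := Real.sqrt_pos.2 (sub_pos.2 hσ)
  have h1 : Real.sqrt (n - σ) ^ 2 = n - σ := Real.sq_sqrt (sub_pos.2 hσ).le
  have h2 : Real.sqrt (n - (σ + δ)) ^ 2 = n - (σ + δ) := Real.sq_sqrt (by linarith)
  have h3 : 1 / (2 * Real.sqrt (n - σ)) * δ ≤ Real.sqrt (n - σ) - Real.sqrt (n - (σ + δ)) := by
    rw [one_div, inv_mul_le_iff₀ (by positivity)]
    nlinarith [sq_nonneg (Real.sqrt (n - σ) - Real.sqrt (n - (σ + δ)))]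
  have h4 := mul_le_mul_of_nonneg_left h3 hK
  have h5 : K / (2 * Real.sqrt (n - σ)) * δ = K * (1 / (2 * Real.sqrt (n - σ)) * δ) := by ring
  unfold barrierHeight
  rw [h5]
  linarith

/-- If the barrier potential is controlled and many coordinates lie strictly inside the cube,
then the point can be moved so that its norm grows and the potential stays controlled. -/
theorem exists_norm_gt_of_many_active {n : ℕ} {ι : Type*} [Fintype ι] [Nonempty ι]
    (a : ι → EuclideanSpace ℝ (Fin n)) (ha : ∀ j i, |a j i| ≤ 1) {κ K c : ℝ}
    (hK : 0 < K) (hc : 0 < c) (hKc : 12 < K * c) (x : EuclideanSpace ℝ (Fin n))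
    (hx : ∀ i, |x i| ≤ 1)
    (hs : ∀ j, 0 < barrierHeight n κ K (‖x‖ ^ 2) - ⟪a j, x⟫)
    (hpot : ∑ j, 1 / (barrierHeight n κ K (‖x‖ ^ 2) - ⟪a j, x⟫) ^ 2 ≤ 1 / c ^ 2)
    (hact : 8 ≤ (Finset.univ.filter fun i => |x i| < 1).card) :
    ∃ y : EuclideanSpace ℝ (Fin n), ‖x‖ < ‖y‖ ∧ (∀ i, |y i| ≤ 1) ∧
      (∀ j, 0 < barrierHeight n κ K (‖y‖ ^ 2) - ⟪a j, y⟫) ∧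
      ∑ j, 1 / (barrierHeight n κ K (‖y‖ ^ 2) - ⟪a j, y⟫) ^ 2 ≤ 1 / c ^ 2 := by
  classical
  set A := Finset.univ.filter fun i => |x i| < 1 with hAdef
  set s : ι → ℝ := fun j => barrierHeight n κ K (‖x‖ ^ 2) - ⟪a j, x⟫ with hsdef
  have hr : (0 : ℝ) < A.card := by exact_mod_cast (by omega : 0 < A.card)
  have hA : A.Nonempty := Finset.card_pos.1 (by omega)
  -- heavy rows
  let H : Finset ι := Finset.univ.filter fun j => 4 / (c ^ 2 * A.card) < 1 / s j ^ 2
  have hH : 4 * H.card ≤ A.card := by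
    have h1 : H.card • (4 / (c ^ 2 * A.card)) ≤ ∑ j ∈ H, 1 / s j ^ 2 :=
      Finset.card_nsmul_le_sum _ _ _ fun j hj => (Finset.mem_filter.1 hj).2.le
    have h2 : ∑ j ∈ H, 1 / s j ^ 2 ≤ ∑ j, 1 / s j ^ 2 :=
      Finset.sum_le_sum_of_subset_of_nonneg (Finset.subset_univ _) fun j _ _ => by positivity
    have h3 := h1.trans (h2.trans hpot)
    rw [nsmul_eq_mul, ← mul_div_assoc, div_le_div_iff₀ (by positivity) (by positivity)] at h3
    have h4 : c ^ 2 * (4 * H.card : ℝ) ≤ c ^ 2 * A.card := by linarith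
    exact_mod_cast le_of_mul_le_mul_left h4 (by positivity)
  let g : EuclideanSpace ℝ (Fin n) := ∑ j, (1 / s j ^ 3) • a j
  let S : Finset (EuclideanSpace ℝ (Fin n)) := {x, g} ∪ H.image a
  -- `2 + |A|/4 ≤ |A|/2` is exactly where `8 ≤ |A|` enters.
  have hS : 2 * S.card ≤ A.card := by
    have h1 : S.card ≤ ({x, g} : Finset _).card + (H.image a).card := Finset.card_union_le _ _
    have h2 : ({x, g} : Finset (EuclideanSpace ℝ (Fin n))).card ≤ 2 := Finset.card_le_two
    have h3 : (H.image a).card ≤ H.card := Finset.card_image_le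
    omega
  obtain ⟨u, hu0, husupp, huS, hutr⟩ := exists_direction A S (fun j => 1 / s j ^ 3)
    (fun j => by have := hs j; positivity) a ha hA hS
  have hux : ⟪x, u⟫ = 0 := huS x (by simp [S])
  have hug : ∑ j, ⟪a j, u⟫ / s j ^ 3 = 0 := by
    have h := huS g (by simp [S])
    simp only [g, sum_inner, inner_smul_left] at h
    rw [← h]
    refine Finset.sum_congr rfl fun j _ => ?_
    simp
    ring
  have huH : ∀ j ∈ H, ⟪a j, u⟫ = 0 := fun j hj =>
    huS _ (Finset.mem_union_right _ (Finset.mem_image_of_mem _ hj))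
  have hupos : 0 < ‖u‖ := norm_pos_iff.2 hu0
  have hWpos : 0 < ∑ j, 1 / s j ^ 3 :=
    Finset.sum_pos (fun j _ => by have := hs j; positivity) Finset.univ_nonempty
  -- remaining energy
  have hdef : (n : ℝ) - ‖x‖ ^ 2 = ∑ i, (1 - x i ^ 2) := by
    rw [EuclideanSpace.norm_sq_eq]
    simp
  -- Coordinates outside `A` have absolute value 1 and carry no remaining energy.
  have hdef_le : (n : ℝ) - ‖x‖ ^ 2 ≤ A.card := by
    rw [hdef]
    calc ∑ i, (1 - x i ^ 2) ≤ ∑ i, if i ∈ A then (1 : ℝ) else 0 := by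
          refine Finset.sum_le_sum fun i _ => ?_
          split_ifs with hi
          · nlinarith [sq_nonneg (x i)]
          · have h1 : 1 ≤ |x i| := by simpa [A] using hi
            rw [← sq_abs]
            nlinarith
      _ = A.card := by simp
  have hlt : ‖x‖ ^ 2 < n := by
    rw [← sub_pos, hdef]
    obtain ⟨i, hi⟩ := hA
    refine Finset.sum_pos' (fun i _ => ?_) ⟨i, Finset.mem_univ _, ?_⟩
    · have := hx i
      rw [← sq_abs]
      nlinarith [abs_nonneg (x i)]
    · have : |x i| < 1 := by simpa [A] using hi
      rw [← sq_abs]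
      nlinarith [abs_nonneg (x i)]
  set q := Real.sqrt (n - ‖x‖ ^ 2) with hq
  have hqpos : 0 < q := Real.sqrt_pos.2 (sub_pos.2 hlt)
  have hqr : q ≤ Real.sqrt A.card := Real.sqrt_le_sqrt hdef_le
  have hrpos : 0 < Real.sqrt A.card := Real.sqrt_pos.2 hr
  set β := K / (2 * q) * ‖u‖ ^ 2 with hβ
  have hsecond : 3 * ∑ j, ⟪a j, u⟫ ^ 2 / s j ^ 4 < 2 * β * ∑ j, 1 / s j ^ 3 := by
    -- Heavy rows do not move; for light rows one factor `1 / s j` is at most `2 / (c√|A|)`. With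
    -- the factor 2 from averaging and the 3 from the Taylor term this makes the 12 in `hKc`.
    have hterm : ∀ j, ⟪a j, u⟫ ^ 2 / s j ^ 4 ≤
        2 / (c * Real.sqrt A.card) * (1 / s j ^ 3 * ⟪a j, u⟫ ^ 2) := by
      intro j
      have hsj : 0 < s j := hs j
      by_cases hj : j ∈ H
      · simp [huH j hj]
      · have h1 : 1 / s j ^ 2 ≤ 4 / (c ^ 2 * A.card) := by simpa [H] using hj
        have h2 : 1 / s j ≤ 2 / (c * Real.sqrt A.card) := by
          refine le_of_sq_le_sq ?_ (by positivity)
          rw [div_pow, div_pow, mul_pow, Real.sq_sqrt hr.le]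
          norm_num at h1 ⊢
          exact h1
        have h3 : ⟪a j, u⟫ ^ 2 / s j ^ 4 = 1 / s j * (1 / s j ^ 3 * ⟪a j, u⟫ ^ 2) := by
          field_simp
        rw [h3]
        exact mul_le_mul_of_nonneg_right h2 (by positivity)
    have h1 : ∑ j, ⟪a j, u⟫ ^ 2 / s j ^ 4 ≤
        2 / (c * Real.sqrt A.card) * (2 * (∑ j, 1 / s j ^ 3) * ‖u‖ ^ 2) := by
      refine (Finset.sum_le_sum fun j _ => hterm j).trans ?_
      rw [← Finset.mul_sum]
      exact mul_le_mul_of_nonneg_left hutr (by positivity)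
    have h2 : 12 / (c * Real.sqrt A.card) < K / q := by
      rw [div_lt_div_iff₀ (by positivity) hqpos]
      nlinarith
    calc 3 * ∑ j, ⟪a j, u⟫ ^ 2 / s j ^ 4
        ≤ 3 * (2 / (c * Real.sqrt A.card) * (2 * (∑ j, 1 / s j ^ 3) * ‖u‖ ^ 2)) := by linarith
      _ = 12 / (c * Real.sqrt A.card) * ((∑ j, 1 / s j ^ 3) * ‖u‖ ^ 2) := by ring
      _ < K / q * ((∑ j, 1 / s j ^ 3) * ‖u‖ ^ 2) :=
          mul_lt_mul_of_pos_right h2 (by positivity)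
      _ = 2 * β * ∑ j, 1 / s j ^ 3 := by rw [hβ]; field_simp
  have hev := eventually_sum_inv_sq_le s (fun j => ⟪a j, u⟫) β hs hug hsecond
  have hcube : ∀ᶠ ε in nhds (0 : ℝ), ∀ i, |(x + ε • u) i| ≤ 1 := by
    rw [Filter.eventually_all]
    intro i
    by_cases hi : i ∈ A
    · have h1 : |x i| < 1 := by simpa [A] using hi
      have h2 : ContinuousAt (fun ε : ℝ => |x i + ε * u i|) 0 := by fun_prop
      have h3 := h2.eventually_lt (continuousAt_const (y := (1 : ℝ))) (by simpa using h1)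
      filter_upwards [h3] with ε hε
      simpa using hε.le
    · refine Filter.Eventually.of_forall fun ε => ?_
      simpa [husupp i hi] using hx i
  obtain ⟨ε, ⟨⟨hεs, hεpot⟩, hεcube⟩, hεpos⟩ :=
    ((hev.and hcube).filter_mono nhdsWithin_le_nhds |>.and
      (self_mem_nhdsWithin (a := (0 : ℝ)) (s := Set.Ioi 0))).exists
  have hε0 : 0 < ε := hεpos
  set y := x + ε • u with hy
  have hnorm : ‖y‖ ^ 2 = ‖x‖ ^ 2 + ε ^ 2 * ‖u‖ ^ 2 := by
    rw [hy, norm_add_sq_real, inner_smul_right, hux, norm_smul, Real.norm_eq_abs, mul_pow, sq_abs]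
    ring
  have hyn : ‖y‖ ^ 2 ≤ n := by
    rw [EuclideanSpace.norm_sq_eq]
    calc ∑ i, ‖y i‖ ^ 2 ≤ ∑ i : Fin n, (1 : ℝ) := Finset.sum_le_sum fun i _ => by
          have := hεcube i
          rw [Real.norm_eq_abs]
          nlinarith [abs_nonneg (y i)]
      _ = n := by simp
  have hslack : ∀ j, s j + ε * (β * ε - ⟪a j, u⟫) ≤
      barrierHeight n κ K (‖y‖ ^ 2) - ⟪a j, y⟫ := by
    intro j
    have h := barrierHeight_add_ge (κ := κ) hK.le hlt (δ := ε ^ 2 * ‖u‖ ^ 2) (hnorm ▸ hyn)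
    rw [← hnorm] at h
    have h2 : ⟪a j, y⟫ = ⟪a j, x⟫ + ε * ⟪a j, u⟫ := by
      rw [hy, inner_add_right, inner_smul_right]
    have h3 : K / (2 * q) * (ε ^ 2 * ‖u‖ ^ 2) = ε * (β * ε) := by rw [hβ]; ring
    rw [← hq, h3] at h
    simp only [hsdef]
    rw [h2]
    linarith
  refine ⟨y, ?_, hεcube, fun j => (hεs j).trans_le (hslack j), ?_⟩
  · refine lt_of_pow_lt_pow_left₀ 2 (norm_nonneg _) ?_
    rw [hnorm]
    have : 0 < ε ^ 2 * ‖u‖ ^ 2 := by positivity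
    linarith
  · refine (Finset.sum_le_sum fun j _ => ?_).trans (hεpot.trans hpot)
    have h0 := hεs j
    exact one_div_le_one_div_of_le (by positivity) (pow_le_pow_left₀ h0.le (hslack j) 2)

/-- One-sided discrepancy bound for `m` linear forms in `n` variables; typically `m = O(n)`,
`κ = O(√n)` and `c`, `K` are constants. -/
theorem exists_signs_inner_le {n : ℕ} {ι : Type*} [Fintype ι] [Nonempty ι]
    (a : ι → EuclideanSpace ℝ (Fin n)) (ha : ∀ j i, |a j i| ≤ 1) {κ K c : ℝ}
    (hκ : 0 < κ) (hc : 0 < c) (hK : 0 < K) (hKc : 12 < K * c)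
    (hcard : Fintype.card ι * c ^ 2 ≤ κ ^ 2) :
    ∃ x : Fin n → ℝ, (∀ i, x i = -1 ∨ x i = 1) ∧
      ∀ j, ∑ i, a j i * x i ≤ κ + K * Real.sqrt n + 16 := by
  classical
  let s : ι → EuclideanSpace ℝ (Fin n) → ℝ := fun j x => barrierHeight n κ K (‖x‖ ^ 2) - ⟪a j, x⟫
  have hscont : ∀ j, Continuous (s j) := fun j =>
    ((continuous_barrierHeight n κ K).comp (by fun_prop)).sub (by fun_prop)
  -- The truncation by `max` keeps the potential continuous everywhere, so `C` is closed; on `C` it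
  -- changes nothing.
  let C : Set (EuclideanSpace ℝ (Fin n)) :=
    {x | (∀ i, |x i| ≤ 1) ∧ (∀ j, c ≤ s j x) ∧ ∑ j, 1 / (max (s j x) c) ^ 2 ≤ 1 / c ^ 2}
  have hmem : ∀ x, (∀ i, |x i| ≤ 1) → (∀ j, 0 < s j x) → ∑ j, 1 / (s j x) ^ 2 ≤ 1 / c ^ 2 →
      x ∈ C := by
    intro x h1 h2 h3
    have h4 : ∀ j, c ≤ s j x := by
      intro j
      have h5 := (Finset.single_le_sum (f := fun j => 1 / (s j x) ^ 2)
        (fun j _ => by positivity) (Finset.mem_univ j)).trans h3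
      have h2j := h2 j
      rw [one_div_le_one_div (by positivity) (by positivity)] at h5
      exact le_of_sq_le_sq h5 h2j.le
    exact ⟨h1, h4, by simpa only [max_eq_left (h4 _)] using h3⟩
  have hCclosed : IsClosed C := by
    have h : C = (⋂ i, {x | |x i| ≤ 1}) ∩ ((⋂ j, {x | c ≤ s j x}) ∩
        {x | ∑ j, 1 / (max (s j x) c) ^ 2 ≤ 1 / c ^ 2}) := by
      ext x
      simp [C]
    rw [h]
    refine IsClosed.inter (isClosed_iInter fun i => isClosed_le (by fun_prop) continuous_const)
      (IsClosed.inter (isClosed_iInter fun j => isClosed_le continuous_const (hscont j)) ?_)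
    · refine isClosed_le (continuous_finsetSum _ fun j _ => ?_) continuous_const
      refine continuous_const.div (((hscont j).max continuous_const).pow 2) fun x => ?_
      have : 0 < max (s j x) c := lt_max_of_lt_right hc
      positivity
  have hCcompact : IsCompact C := by
    refine (isCompact_closedBall (0 : EuclideanSpace ℝ (Fin n)) (Real.sqrt n)).of_isClosed_subset
      hCclosed fun x hx => ?_
    rw [mem_closedBall_zero_iff]
    refine Real.le_sqrt_of_sq_le ?_
    rw [EuclideanSpace.norm_sq_eq]
    calc ∑ i, ‖x i‖ ^ 2 ≤ ∑ i : Fin n, (1 : ℝ) := Finset.sum_le_sum fun i _ => by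
          have := hx.1 i
          rw [Real.norm_eq_abs]
          nlinarith [abs_nonneg (x i)]
      _ = n := by simp
  have hC0 : (0 : EuclideanSpace ℝ (Fin n)) ∈ C := by
    have h0 : ∀ j, s j 0 = κ := fun j => by simp [s, barrierHeight]
    refine hmem 0 (by simp) (fun j => by rw [h0]; exact hκ) ?_
    simp only [h0, Finset.sum_const, Finset.card_univ, nsmul_eq_mul]
    rw [mul_one_div, div_le_div_iff₀ (by positivity) (by positivity)]
    linarith
  obtain ⟨x, hxC, hxmax⟩ := hCcompact.exists_isMaxOn ⟨0, hC0⟩ continuous_norm.continuousOn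
  obtain ⟨hx1, hxs, hxpot⟩ := hxC
  simp only [max_eq_left (hxs _)] at hxpot
  have hact : (Finset.univ.filter fun i => |x i| < 1).card < 8 := by
    by_contra! h
    obtain ⟨y, hy, hy1, hy2, hy3⟩ := exists_norm_gt_of_many_active a ha hK hc hKc x hx1
      (fun j => hc.trans_le (hxs j)) hxpot h
    exact (hxmax (hmem y hy1 hy2 hy3)).not_gt hy
  -- Each rounded coordinate moves by less than 2, and there are fewer than 8 of them: hence the 16.
  let z : Fin n → ℝ := fun i => if |x i| < 1 then 1 else x i
  refine ⟨z, fun i => ?_, fun j => ?_⟩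
  · by_cases hi : |x i| < 1
    · simp [z, hi]
    · have h1 : |x i| = 1 := le_antisymm (hx1 i) (not_lt.1 hi)
      simpa [z, hi] using (eq_or_eq_neg_of_abs_eq h1).symm
  · have h1 : ∑ i, a j i * x i ≤ κ + K * Real.sqrt n := by
      have h2 := hc.le.trans (hxs j)
      have h3 : ⟪a j, x⟫ = ∑ i, a j i * x i := by
        rw [PiLp.inner_apply]
        exact Finset.sum_congr rfl fun i _ => by simp [mul_comm]
      have h4 : barrierHeight n κ K (‖x‖ ^ 2) ≤ κ + K * Real.sqrt n := by
        unfold barrierHeight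
        nlinarith [Real.sqrt_nonneg (n - ‖x‖ ^ 2)]
      have h5 : s j x = barrierHeight n κ K (‖x‖ ^ 2) - ⟪a j, x⟫ := rfl
      rw [← h3]
      linarith
    have h2 : ∀ i, a j i * z i ≤ a j i * x i + if |x i| < 1 then 2 else 0 := by
      intro i
      by_cases hi : |x i| < 1
      · simp only [z, hi, if_true]
        have h3 := abs_le.1 (ha j i)
        have h4 := abs_lt.1 hi
        nlinarith
      · simp [z, hi]
    have h3 : ∑ i, (if |x i| < 1 then (2 : ℝ) else 0) ≤ 16 := by
      rw [← Finset.sum_filter, Finset.sum_const, nsmul_eq_mul]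
      have : ((Finset.univ.filter fun i => |x i| < 1).card : ℝ) ≤ 8 := by exact_mod_cast hact.le
      linarith
    have h4 := Finset.sum_le_sum fun i (_ : i ∈ Finset.univ) => h2 i
    rw [Finset.sum_add_distrib] at h4
    linarith

/-! ### Assembling the bound -/

theorem abs_eval_le_chebyshevNorm (p : Polynomial ℝ) {x : ℝ} (hx : |x| ≤ 1) :
    |p.eval x| ≤ chebyshevNorm p :=
  le_csSup (bddAbove_abs_eval p) ⟨x, hx, rfl⟩

theorem chebyshevNorm_le {p : Polynomial ℝ} {M : ℝ} (h : ∀ x : ℝ, |x| ≤ 1 → |p.eval x| ≤ M) :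
    chebyshevNorm p ≤ M := by
  refine csSup_le ⟨_, 0, by simp, rfl⟩ ?_
  rintro _ ⟨x, hx, rfl⟩
  exact h x hx

theorem theorem1 (n : ℕ) (hn : 1 ≤ n) (p : Fin n → Polynomial ℝ)
    (hdeg : ∀ i, (p i).natDegree ≤ n) (hp : ∀ i, chebyshevNorm (p i) ≤ 1) :
    ∃ x : Fin n → ℝ, (∀ i, x i = -1 ∨ x i = 1) ∧
      chebyshevNorm (∑ i, x i • p i) < 30 * Real.sqrt (n : ℝ) := by
  have hp' : ∀ i (t : ℝ), |t| ≤ 1 → |(p i).eval t| ≤ 1 := fun i t ht =>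
    (abs_eval_le_chebyshevNorm _ ht).trans (hp i)
  have hn0 : (0 : ℝ) < n := by exact_mod_cast hn
  have hsq : Real.sqrt n ^ 2 = n := Real.sq_sqrt hn0.le
  have hspos : 0 < Real.sqrt n := Real.sqrt_pos.2 hn0
  have heval : ∀ (x : Fin n → ℝ) (t : ℝ),
      (∑ i, x i • p i).eval t = ∑ i, (p i).eval t * x i := by
    intro x t
    simp [Polynomial.eval_finsetSum, mul_comm]
  -- For `n < 16` the trivial bound `n < 4√n` suffices; otherwise `16 ≤ 4√n` absorbs the rounding
  -- error.
  rcases lt_or_ge n 16 with hsmall | hlarge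
  · refine ⟨fun _ => 1, fun _ => Or.inr rfl, lt_of_le_of_lt (chebyshevNorm_le (M := n) ?_) ?_⟩
    · intro t ht
      rw [heval]
      calc _ ≤ ∑ i, |(p i).eval t * 1| := Finset.abs_sum_le_sum_abs _ _
        _ ≤ ∑ i : Fin n, (1 : ℝ) := Finset.sum_le_sum fun i _ => by simpa using hp' i t ht
        _ = n := by simp
    · have : (n : ℝ) < 16 := by exact_mod_cast hsmall
      nlinarith
  have hs4 : 4 ≤ Real.sqrt n := by
    refine Real.le_sqrt_of_sq_le ?_
    have : (16 : ℝ) ≤ n := by exact_mod_cast hlarge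
    linarith
  have h4n : 4 * n ≠ 0 := by omega
  have hζ := Complex.isPrimitiveRoot_exp (4 * n) h4n
  set ζ := Complex.exp (2 * Real.pi * Complex.I / (4 * n : ℕ)) with hζdef
  have hre : ∀ j : ℕ, |(ζ ^ j).re| ≤ 1 := fun j => by
    refine (Complex.abs_re_le_norm _).trans ?_
    rw [norm_pow, hζ.norm'_eq_one h4n, one_pow]
  let a : Bool × Fin (4 * n) → EuclideanSpace ℝ (Fin n) := fun j =>
    WithLp.toLp 2 fun i => (if j.1 then 1 else -1) * (p i).eval (ζ ^ (j.2 : ℕ)).re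
  have : Nonempty (Bool × Fin (4 * n)) := ⟨(true, ⟨0, by omega⟩)⟩
  -- The constants fit: `6 * 2.1 = 12.6 > 12` and `8n * 2.1² = 35.28n ≤ 36n`. The forms are then at
  -- most `12√n + 16 ≤ 16√n`, and sampling loses a factor `√2 < 1.5`.
  obtain ⟨x, hx, hxa⟩ := exists_signs_inner_le a (κ := 6 * Real.sqrt n) (K := 6) (c := 2.1)
    (fun j i => by
      have := hp' i _ (hre j.2)
      rcases j with ⟨_ | _, j⟩ <;> simpa [a] using this)
    (by positivity) (by norm_num) (by norm_num) (by norm_num) (by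
      rw [mul_pow, hsq]
      simp
      nlinarith)
  refine ⟨x, hx, ?_⟩
  have hnode : ∀ j, |(∑ i, x i • p i).eval (ζ ^ j).re| ≤ 16 * Real.sqrt n := by
    intro j
    have hmod : ζ ^ j = ζ ^ (j % (4 * n)) := (pow_mod_orderOf ζ j).symm.trans (by
      rw [hζ.eq_orderOf.symm])
    have hlt : j % (4 * n) < 4 * n := Nat.mod_lt _ (by omega)
    rw [hmod, heval]
    have h1 := hxa (true, ⟨_, hlt⟩)
    have h2 := hxa (false, ⟨_, hlt⟩)
    simp only [a, if_true, Bool.false_eq_true, if_false, one_mul, neg_mul,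
      Finset.sum_neg_distrib] at h1 h2
    rw [abs_le]
    constructor <;> linarith
  have hdeg' : (∑ i, x i • p i).natDegree ≤ n :=
    Polynomial.natDegree_sum_le_of_forall_le _ _ fun i _ =>
      (Polynomial.natDegree_smul_le _ _).trans (hdeg i)
  refine (chebyshevNorm_le fun t ht =>
    abs_eval_le_of_roots (by omega) hζ _ hdeg' hnode ht).trans_lt ?_
  have h2 : Real.sqrt 2 < 1.5 := by
    rw [Real.sqrt_lt' (by norm_num)]
    norm_num
  nlinarith
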